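/- Let $m\neq\pm1$ be a square-free rational integer, let $\alpha$ be a root of $x^{12}-m$ (which is then irreducible over $\mathbb Q$), let $K=\mathbb Q(\alpha)$, and let $\mathbb Z_K$ be the ring of integers of $K$. Below, the $\mathfrak p_{ijk}$ are pairwise distinct nonzero prime ideals of $\mathbb Z_K$, and $f_{ijk}$ denotes the residue degree of $\mathfrak p_{ijk}$ over the rational prime $p\in\{2,3\}$ below it; the exponents are the ramification indices. 1. If $m\equiv 1\pmod{16}$, then $2\mathbb Z_K=\mathfrak p_{111}\mathfrak p_{121}\mathfrak p_{131}^2\mathfrak p_{211}\mathfrak p_{221}\mathfrak p_{231}^2$ with $f_{111}=f_{121}=f_{131}=1$ and $f_{211}=f_{221}=f_{231}=2$. 2. If $m\equiv 9\pmod{16}$, then $2\mathbb Z_K=\mathfrak p_{111}\mathfrak p_{121}^2\mathfrak p_{211}\mathfrak p_{212}\mathfrak p_{221}^2$ with $f_{121}=1$ and $f_{111}=f_{211}=f_{212}=f_{221}=2$. 3. If $m\equiv 5\pmod 8$, then $2\mathbb Z_K=\mathfrak p_{111}^2\mathfrak p_{211}^2\mathfrak p_{212}^2$ with $f_{111}=f_{211}=f_{212}=2$.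 4. If $m\equiv 1\pmod 9$, then $3\mathbb Z_K=\mathfrak p_{111}\mathfrak p_{121}^2\mathfrak p_{211}\mathfrak p_{221}^2\mathfrak p_{311}\mathfrak p_{321}^2$ with $f_{111}=f_{121}=f_{211}=f_{221}=1$ and $f_{311}=f_{321}=2$. 5. If $m\equiv -1\pmod 9$, then $3\mathbb Z_K=\mathfrak p_{111}\mathfrak p_{121}^2\mathfrak p_{211}\mathfrak p_{221}^2$ with $f_{111}=f_{121}=f_{211}=f_{221}=2$. -/

import Mathlib

open scoped NumberField

/-- The ideal `p 𝓞_K` is the product of the powers `P i ^ e i` of pairwise distinct nonzero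
prime ideals `P i` of the ring of integers (so that `e i` is the ramification index of `P i`
over `p`), and the residue degree of `P i` over `p` is `f i`. -/
def IsPrimeFactorization (K : Type*) [Field K] [NumberField K] (p : ℕ) {r : ℕ}
    (P : Fin r → Ideal (𝓞 K)) (e f : Fin r → ℕ) : Prop :=
  (∀ i, (P i).IsPrime ∧ P i ≠ ⊥) ∧
  Function.Injective P ∧
  (∀ i, 0 < e i) ∧
  Ideal.span {(p : 𝓞 K)} = ∏ i, P i ^ e i ∧
  ∀ i, (P i).inertiaDeg ℤ = f i

/-! Fix a ring map π from the algebraic integers in ℂ to a field `k` of characteristic p. For every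
embedding φ of 𝓞 K into 𝓞 ℂ, the kernel of π ∘ φ is a prime of K over p. Factoring 2 or 3 thus means
finding enough embeddings with different kernels, and neither an integral basis nor Newton polygons
are needed.

The kernels are told apart by the residues of `a` and a few integral elements: ω = (1 + a⁶)/2 and w
= (1 + a³)ω/2 over 2, and θ = (1 + y + y²)/3 with y = εa⁴, ε = ±1, over 3. Monic polynomials split
over 𝓞 ℂ, so any residues that solve the reduced defining equations lift and come from an embedding
(`exists_hom_five_mod_eight`, `exists_hom_one_mod_eight`, `exists_hom_three`).

A residue moved by Frobenius gives f ≥ 2. The identities (a³ + 1)² = 2(ω + a³) and (y - 1)² = 3(θ -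
y) give e ≥ 2 where the cofactor is a unit at the prime. In each case these lower bounds already add
up to 12 = [K : ℚ], so they are exact and no prime is missing (`isPrimeFactorization_of_sum_eq`). -/

open Polynomial in
/-- Monic polynomials over the ring of algebraic integers split there, so that roots of
reductions lift to roots. -/
theorem exists_root_lift {k : Type*} [Field k] (π : 𝓞 ℂ →+* k) {f : (𝓞 ℂ)[X]} (hf : f.Monic)
    {c : k} (hc : f.eval₂ π c = 0) : ∃ b : 𝓞 ℂ, f.eval b = 0 ∧ π b = c := by
  let g : ℂ[X] := f.map (algebraMap (𝓞 ℂ) ℂ)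
  have hg : g.Monic := hf.map _
  have hroot : ∀ z ∈ g.roots, ∃ y : 𝓞 ℂ, (y : ℂ) = z := by
    intro z hz
    have hz' : IsIntegral (𝓞 ℂ) z := by
      refine ⟨f, hf, ?_⟩
      have := (mem_roots hg.ne_zero).1 hz
      rwa [IsRoot, eval_map] at this
    have : IsIntegral ℤ z := isIntegral_trans z hz'
    exact ⟨⟨z, this⟩, rfl⟩
  choose! lift hlift using hroot
  have hprod : f = ((g.roots.map lift).map fun a => X - C a).prod := by
    apply map_injective (algebraMap (𝓞 ℂ) ℂ) NumberField.RingOfIntegers.coe_injective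
    have h := (IsAlgClosed.splits g).eq_prod_roots
    rw [hg.leadingCoeff, C_1, one_mul] at h
    change g = _
    rw [Polynomial.map_multiset_prod, Multiset.map_map, Multiset.map_map]
    conv_lhs => rw [h]
    congr 1
    apply Multiset.map_congr rfl
    intro z hz
    simp [hlift z hz]
  have hc' := hc
  -- In the field `k` the vanishing product of the reduced linear factors has a vanishing factor.
  rw [hprod, eval₂_multiset_prod] at hc'
  simp only [Multiset.map_map, Multiset.prod_eq_zero_iff, Multiset.mem_map] at hc'
  obtain ⟨z, hz, h⟩ := hc'
  refine ⟨lift z, ?_, ?_⟩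
  · rw [hprod, eval_multiset_prod]
    simp only [Multiset.map_map, Multiset.prod_eq_zero_iff, Multiset.mem_map]
    exact ⟨z, hz, by simp⟩
  · simpa [sub_eq_zero, @eq_comm _ (π _)] using h

open Polynomial in
/-- Monic polynomials of positive degree have roots in the ring of algebraic integers. -/
theorem exists_root_of_monic {f : (𝓞 ℂ)[X]} (hf : f.Monic) (hd : f.natDegree ≠ 0) :
    ∃ b : 𝓞 ℂ, f.eval b = 0 := by
  have hinj := NumberField.RingOfIntegers.coe_injective (K := ℂ)
  obtain ⟨z, hz⟩ := IsAlgClosed.exists_root (f.map (algebraMap (𝓞 ℂ) ℂ)) (by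
    rw [degree_map_eq_of_injective hinj, degree_eq_natDegree hf.ne_zero]
    exact_mod_cast hd)
  have hz' : IsIntegral (𝓞 ℂ) z := ⟨f, hf, by rwa [IsRoot, eval_map] at hz⟩
  have : IsIntegral ℤ z := isIntegral_trans z hz'
  obtain ⟨y, rfl⟩ : ∃ y : 𝓞 ℂ, algebraMap (𝓞 ℂ) ℂ y = z := ⟨⟨z, this⟩, rfl⟩
  refine ⟨y, hinj ?_⟩
  rw [map_zero, ← hz, eval_map_algebraMap, aeval_algebraMap_apply]
  rfl

/-- Reduction of the algebraic integers modulo a maximal ideal over a rational prime. -/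
theorem exists_reduction (p : ℕ) (hp : p.Prime) :
    ∃ (k : Type) (_ : Field k) (_ : 𝓞 ℂ →+* k), (p : k) = 0 := by
  have hnu : ¬ IsUnit (p : 𝓞 ℂ) := by
    intro h
    obtain ⟨x, hx⟩ := h.exists_right_inv
    have hx' : (p : ℂ) * (x : ℂ) = 1 := by exact_mod_cast congrArg (algebraMap (𝓞 ℂ) ℂ) hx
    have hp0 : (p : ℂ) ≠ 0 := by exact_mod_cast hp.ne_zero
    have hint : IsIntegral ℤ (algebraMap ℚ ℂ ((p : ℚ)⁻¹)) := by
      have : algebraMap ℚ ℂ ((p : ℚ)⁻¹) = (x : ℂ) := by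
        simp only [map_inv₀, map_natCast]
        exact inv_eq_of_mul_eq_one_right hx'
      rw [this]
      exact x.isIntegral_coe
    rw [isIntegral_algebraMap_iff (algebraMap ℚ ℂ).injective] at hint
    obtain ⟨n, hn⟩ := IsIntegrallyClosed.isIntegral_iff.1 hint
    have hp0' : (p : ℚ) ≠ 0 := by exact_mod_cast hp.ne_zero
    have h1 : (n : ℚ) * p = 1 := by
      have : (n : ℚ) = (p : ℚ)⁻¹ := by simpa using hn
      rw [this, inv_mul_cancel₀ hp0']
    have h2 : n * (p : ℤ) = 1 := by exact_mod_cast h1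
    have h3 : (p : ℤ) ∣ 1 := Dvd.intro_left n h2
    exact hp.one_lt.ne' (by exact_mod_cast Int.eq_one_of_dvd_one (by positivity) h3)
  obtain ⟨M, hM, hpM⟩ := exists_max_ideal_of_mem_nonunits hnu
  refine ⟨𝓞 ℂ ⧸ M, Ideal.Quotient.field M, Ideal.Quotient.mk M, ?_⟩
  have := Ideal.Quotient.eq_zero_iff_mem.2 hpM
  simpa using this

/-! ### Pure fields: degree and embeddings. -/

section PureField

open Polynomial

/-- Eisenstein at any prime divisor of `m`, followed by Gauss's lemma. -/
theorem irreducible_X_pow_sub_C_of_squarefree {n : ℕ} (hn : n ≠ 0) {m : ℤ} (hm : Squarefree m)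
    (hu : ¬ IsUnit m) : Irreducible (X ^ n - C (m : ℚ)) := by
  have hm0 : m ≠ 0 := hm.ne_zero
  obtain ⟨q, hq, hqm⟩ := WfDvdMonoid.exists_irreducible_factor hu hm0
  have hqp : Prime q := hq.prime
  have hmonic : (X ^ n - C m : ℤ[X]).Monic := monic_X_pow_sub_C m hn
  have hP : (Ideal.span {q}).IsPrime := (Ideal.span_singleton_prime hqp.ne_zero).2 hqp
  have hE : (X ^ n - C m : ℤ[X]).IsEisensteinAt (Ideal.span {q}) := by
    refine hmonic.isEisensteinAt_of_mem_of_notMem hP.ne_top ?_ ?_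
    · intro i hi
      rw [natDegree_X_pow_sub_C] at hi
      rw [coeff_sub, coeff_X_pow, if_neg hi.ne, zero_sub, coeff_C]
      split_ifs
      · exact neg_mem (Ideal.mem_span_singleton.2 hqm)
      · simp
    · rw [coeff_sub, coeff_X_pow, if_neg hn.symm, zero_sub, coeff_C_zero, neg_mem_iff,
        Ideal.span_singleton_pow, Ideal.mem_span_singleton, sq]
      intro h
      exact hq.not_isUnit (hm q h)
  have hirr := hE.irreducible hP hmonic.isPrimitive
    (by rw [natDegree_X_pow_sub_C]; exact Nat.pos_of_ne_zero hn)
  have := (hmonic.irreducible_iff_irreducible_map_fraction_map (K := ℚ)).1 hirr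
  simpa using this

variable {K : Type*} [Field K] [NumberField K] {n : ℕ} {m : ℤ} {α : K}

theorem minpoly_eq_X_pow_sub_C (hn : n ≠ 0) (hm : Squarefree m) (hu : ¬ IsUnit m)
    (hα : α ^ n = (m : K)) : minpoly ℚ α = X ^ n - C (m : ℚ) :=
  (minpoly.eq_of_irreducible_of_monic (irreducible_X_pow_sub_C_of_squarefree hn hm hu)
    (by simp [hα]) (monic_X_pow_sub_C _ hn)).symm

theorem finrank_pureField (hn : n ≠ 0) (hm : Squarefree m) (hu : ¬ IsUnit m)
    (hα : α ^ n = (m : K)) (hK : IntermediateField.adjoin ℚ {α} = ⊤) :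
    Module.finrank ℚ K = n := by
  have hi : IsIntegral ℚ α := Algebra.IsIntegral.isIntegral α
  rw [← IntermediateField.finrank_top', ← hK, IntermediateField.adjoin.finrank hi,
    minpoly_eq_X_pow_sub_C hn hm hu hα, natDegree_X_pow_sub_C]

theorem exists_hom_pureField (hn : n ≠ 0) (hm : Squarefree m) (hu : ¬ IsUnit m) {a : 𝓞 K}
    (ha : a ^ n = (m : 𝓞 K)) {b : 𝓞 ℂ} (hb : b ^ n = (m : 𝓞 ℂ)) :
    ∃ φ : 𝓞 K →+* 𝓞 ℂ, φ a = b := by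
  have ha' : (a : K) ^ n = (m : K) := by simpa using congrArg (algebraMap (𝓞 K) K) ha
  have hb' : (b : ℂ) ^ n = (m : ℂ) := by simpa using congrArg (algebraMap (𝓞 ℂ) ℂ) hb
  obtain ⟨ψ, hψ⟩ := IntermediateField.exists_algHom_of_splits_of_aeval (F := ℚ) (E := K)
    (fun x => ⟨Algebra.IsIntegral.isIntegral x, IsAlgClosed.splits _⟩)
    (x := (a : K)) (y := (b : ℂ))
    (by rw [minpoly_eq_X_pow_sub_C hn hm hu ha']; simp [hb'])
  exact ⟨NumberField.RingOfIntegers.mapRingHom ψ.toRingHom,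
    NumberField.RingOfIntegers.coe_injective hψ⟩

end PureField

/-! ### From lower bounds on e and f to a complete factorization. -/

section Assembly

variable {K : Type*} [Field K] [NumberField K]

/-- A family of distinct primes over `p` whose ramification indices and residue degrees are at
least `e i` and `f i`, where `∑ e i * f i` is the degree, is the complete factorization. -/
theorem isPrimeFactorization_of_sum_eq {p : ℕ} (hp : p.Prime) {r : ℕ} {P : Fin r → Ideal (𝓞 K)}
    {e f : Fin r → ℕ} (hP : ∀ i, (P i).IsPrime) (hmem : ∀ i, (p : 𝓞 K) ∈ P i)
    (hinj : Function.Injective P) (he : ∀ i, 0 < e i)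
    (hdvd : ∀ i, P i ^ e i ∣ Ideal.span {(p : 𝓞 K)}) (hf : ∀ i, f i ≤ (P i).inertiaDeg ℤ)
    (hsum : ∑ i, e i * f i = Module.finrank ℚ K) : IsPrimeFactorization K p P e f := by
  have hp0 : (p : 𝓞 K) ≠ 0 := by exact_mod_cast hp.ne_zero
  have hbot : ∀ i, P i ≠ ⊥ := fun i h => hp0 (by simpa [h] using hmem i)
  have hpZ : (Ideal.span {(p : ℤ)}).IsMaximal :=
    PrincipalIdealRing.isMaximal_of_irreducible (Nat.prime_iff_prime_int.1 hp).irreducible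
  have hmax : ∀ i, (P i).IsMaximal := fun i => (hP i).isMaximal (hbot i)
  have hover : ∀ i, (P i).LiesOver (Ideal.span {(p : ℤ)}) := fun i => by
    constructor
    refine hpZ.eq_of_le ((hP i).comap _).ne_top ?_
    rw [Ideal.span_singleton_le_iff_mem, Ideal.mem_comap]
    simpa using hmem i
  have hnorm : ∀ i, Ideal.absNorm (P i) = p ^ (P i).inertiaDeg ℤ := fun i => by
    rw [Ideal.absNorm_eq_pow_inertiaDeg' (P i) hp, Ideal.inertiaDeg'_eq_inertiaDeg]
  have hpow : ∏ i, P i ^ e i ∣ Ideal.span {(p : 𝓞 K)} :=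
    Fintype.prod_dvd_of_coprime
      (fun i j hij => (Ideal.isCoprime_of_isMaximal (hinj.ne hij)).pow) hdvd
  obtain ⟨Q, hQ⟩ := hpow
  -- Comparing norms bounds the sum of e·f from above by the degree; with the lower bounds this
  -- forces equality and leaves norm 1 for the cofactor `Q`.
  have hN : p ^ (Module.finrank ℚ K) = p ^ (∑ i, e i * (P i).inertiaDeg ℤ) * Ideal.absNorm Q := by
    have := congrArg Ideal.absNorm hQ
    rw [map_mul, map_prod, Ideal.absNorm_span_singleton] at this
    have h1 : (p : 𝓞 K) = algebraMap ℤ (𝓞 K) p := by simp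
    rw [h1, Algebra.norm_algebraMap, NumberField.RingOfIntegers.rank, Int.natAbs_pow,
      Int.natAbs_natCast] at this
    rw [this]
    congr 1
    rw [← Finset.prod_pow_eq_pow_sum]
    refine Finset.prod_congr rfl fun i _ => ?_
    rw [map_pow, hnorm, ← pow_mul, mul_comm]
  have hle : ∑ i, e i * (P i).inertiaDeg ℤ ≤ ∑ i, e i * f i := by
    rw [hsum]
    exact (Nat.pow_dvd_pow_iff_le_right hp.one_lt).1 (Dvd.intro _ hN.symm)
  have hle' : ∀ i ∈ Finset.univ, e i * f i ≤ e i * (P i).inertiaDeg ℤ :=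
    fun i _ => Nat.mul_le_mul_left _ (hf i)
  have heq : ∑ i, e i * f i = ∑ i, e i * (P i).inertiaDeg ℤ :=
    le_antisymm (Finset.sum_le_sum hle') hle
  have hfi : ∀ i, (P i).inertiaDeg ℤ = f i := fun i =>
    (Nat.eq_of_mul_eq_mul_left (he i)
      ((Finset.sum_eq_sum_iff_of_le hle').1 heq i (Finset.mem_univ i))).symm
  have hQ1 : Ideal.absNorm Q = 1 := by
    rw [← heq, hsum] at hN
    exact (Nat.eq_of_mul_eq_mul_left (pow_pos hp.pos _) (by rw [mul_one]; exact hN)).symm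
  rw [Ideal.absNorm_eq_one_iff] at hQ1
  refine ⟨fun i => ⟨hP i, hbot i⟩, hinj, he, ?_, hfi⟩
  rw [hQ, hQ1, Ideal.mul_top]

/-- If `x ∈ P` and `x ^ 2 = p * v` with `v ∉ P`, then `P` is ramified over `p`. -/
theorem sq_dvd_span_of_sq_eq {P : Ideal (𝓞 K)} (hP : P.IsPrime) (hbot : P ≠ ⊥) {p x v : 𝓞 K}
    (hx : x ∈ P) (hxv : x ^ 2 = p * v) (hv : v ∉ P) : P ^ 2 ∣ Ideal.span {p} := by
  refine (Ideal.prime_of_isPrime hbot hP).pow_dvd_of_dvd_mul_right 2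
    (b := Ideal.span {v}) ?_ ?_
  · rwa [Ideal.dvd_span_singleton]
  · rw [Ideal.span_singleton_mul_span_singleton, ← hxv, Ideal.dvd_span_singleton]
    exact Ideal.pow_mem_pow hx 2

/-- A residue field with p elements would be fixed pointwise by Frobenius. -/
theorem two_le_inertiaDeg {p : ℕ} (hp : p.Prime) {P : Ideal (𝓞 K)} (hP : P.IsPrime)
    (hbot : P ≠ ⊥) (hmem : (p : 𝓞 K) ∈ P) {x : 𝓞 K} (hx : x ^ p - x ∉ P) :
    2 ≤ P.inertiaDeg ℤ := by
  have hpos := Ideal.inertiaDeg_pos P ℤ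
  by_contra hlt
  have h1 : P.inertiaDeg ℤ = 1 := by omega
  have hpZ : (Ideal.span {(p : ℤ)}).IsMaximal :=
    PrincipalIdealRing.isMaximal_of_irreducible (Nat.prime_iff_prime_int.1 hp).irreducible
  have hmax : P.IsMaximal := hP.isMaximal hbot
  have hover : P.LiesOver (Ideal.span {(p : ℤ)}) := by
    constructor
    refine hpZ.eq_of_le (hP.comap _).ne_top ?_
    rw [Ideal.span_singleton_le_iff_mem, Ideal.mem_comap]
    simpa using hmem
  have hcard : Nat.card (𝓞 K ⧸ P) = p := by
    have h := Ideal.absNorm_eq_pow_inertiaDeg' P hp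
    rwa [Ideal.inertiaDeg'_eq_inertiaDeg, h1, pow_one, Ideal.absNorm_apply,
      Submodule.cardQuot_apply] at h
  let := Ideal.Quotient.field P
  have hfin : Finite (𝓞 K ⧸ P) := Nat.finite_of_card_ne_zero (by rw [hcard]; exact hp.ne_zero)
  let := Fintype.ofFinite (𝓞 K ⧸ P)
  have := FiniteField.pow_card (Ideal.Quotient.mk P x)
  rw [← Nat.card_eq_fintype_card, hcard, ← map_pow, ← sub_eq_zero, ← map_sub,
    Ideal.Quotient.eq_zero_iff_mem] at this
  exact hx this

/-- Complete factorization from a family of reductions with distinct kernels. -/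
theorem exists_isPrimeFactorization_of_homs {k : Type*} [Field k] {p : ℕ} (hp : p.Prime)
    (hpk : (p : k) = 0) {r : ℕ} (φ : Fin r → 𝓞 K →+* k) {e f : Fin r → ℕ}
    (hinj : ∀ i j, (∀ x, φ i x = 0 ↔ φ j x = 0) → i = j)
    (he : ∀ i, e i = 1 ∨ e i = 2 ∧ ∃ x v, φ i x = 0 ∧ x ^ 2 = (p : 𝓞 K) * v ∧ φ i v ≠ 0)
    (hf : ∀ i, f i = 1 ∨ f i = 2 ∧ ∃ x, φ i x ^ p ≠ φ i x)
    (hsum : ∑ i, e i * f i = Module.finrank ℚ K) :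
    ∃ P : Fin r → Ideal (𝓞 K), IsPrimeFactorization K p P e f := by
  have hp0 : (p : 𝓞 K) ≠ 0 := by exact_mod_cast hp.ne_zero
  have hP : ∀ i, (RingHom.ker (φ i)).IsPrime := fun i => RingHom.ker_isPrime _
  have hmem : ∀ i, (p : 𝓞 K) ∈ RingHom.ker (φ i) := fun i => by simp [RingHom.mem_ker, hpk]
  have hbot : ∀ i, RingHom.ker (φ i) ≠ ⊥ := fun i h => hp0 (by simpa [h] using hmem i)
  refine ⟨fun i => RingHom.ker (φ i), isPrimeFactorization_of_sum_eq hp hP hmem ?_ ?_ ?_ ?_ hsum⟩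
  · intro i j hij
    refine hinj i j fun x => ?_
    rw [← RingHom.mem_ker, ← RingHom.mem_ker]
    exact iff_of_eq (congrArg (x ∈ ·) hij)
  · intro i
    rcases he i with h | h <;> omega
  · intro i
    rcases he i with h | ⟨h, x, v, hx, hxv, hv⟩
    · rw [h, pow_one, Ideal.dvd_span_singleton]
      exact hmem i
    · rw [h]
      exact sq_dvd_span_of_sq_eq (hP i) (hbot i) hx hxv hv
  · intro i
    rcases hf i with h | ⟨h, x, hx⟩
    · have := hP i
      rw [h]
      exact Ideal.inertiaDeg_pos _ ℤ
    · rw [h]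
      refine two_le_inertiaDeg hp (hP i) (hbot i) (hmem i) (x := x) ?_
      simpa [RingHom.mem_ker, sub_eq_zero] using hx

end Assembly

/-! ### Integrality from explicit monic equations. -/

open Polynomial in
theorem exists_coe_eq_of_quadratic {F : Type*} [Field F] (b c : 𝓞 F) {x : F}
    (hx : x ^ 2 - b * x - c = 0) : ∃ y : 𝓞 F, (y : F) = x := by
  have hx' : IsIntegral (𝓞 F) x :=
    ⟨X ^ 2 - C b * X - C c, by monicity!, by simpa using hx⟩
  have : IsIntegral ℤ x := isIntegral_trans x hx'
  exact ⟨⟨x, this⟩, rfl⟩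

open Polynomial in
theorem exists_coe_eq_of_cubic {F : Type*} [Field F] (b c d : 𝓞 F) {x : F}
    (hx : x ^ 3 - b * x ^ 2 - c * x - d = 0) : ∃ y : 𝓞 F, (y : F) = x := by
  have hx' : IsIntegral (𝓞 F) x :=
    ⟨X ^ 3 - C b * X ^ 2 - C c * X - C d, by monicity!, by simpa using hx⟩
  have : IsIntegral ℤ x := isIntegral_trans x hx'
  exact ⟨⟨x, this⟩, rfl⟩

/-! ### Lifting residues to algebraic integers. -/

section Lifts

variable {k : Type*} [Field k]

open Polynomial

theorem exists_quadratic_root (b c : 𝓞 ℂ) : ∃ x : 𝓞 ℂ, x ^ 2 - b * x - c = 0 := by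
  obtain ⟨x, hx⟩ := exists_root_of_monic (f := X ^ 2 - C b * X - C c) (by monicity!)
    (by
      have : (X ^ 2 - C b * X - C c).natDegree = 2 := by compute_degree!
      simp [this])
  exact ⟨x, by simpa using hx⟩

theorem exists_quadratic_root_lift (π : 𝓞 ℂ →+* k) (b c : 𝓞 ℂ) {t : k} (ht : t ^ 2 - π b * t - π c = 0) :
    ∃ x : 𝓞 ℂ, x ^ 2 - b * x - c = 0 ∧ π x = t := by
  obtain ⟨x, hx, hxt⟩ := exists_root_lift π (f := X ^ 2 - C b * X - C c) (by monicity!)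
    (c := t) (by simpa using ht)
  exact ⟨x, by simpa using hx, hxt⟩

theorem exists_cubic_root_lift (π : 𝓞 ℂ →+* k) (b c d : 𝓞 ℂ) {t : k}
    (ht : t ^ 3 - π b * t ^ 2 - π c * t - π d = 0) :
    ∃ x : 𝓞 ℂ, x ^ 3 - b * x ^ 2 - c * x - d = 0 ∧ π x = t := by
  obtain ⟨x, hx, hxt⟩ := exists_root_lift π (f := X ^ 3 - C b * X ^ 2 - C c * X - C d)
    (by monicity!) (c := t) (by simpa using ht)
  exact ⟨x, by simpa using hx, hxt⟩

theorem exists_pow_eq {n : ℕ} (hn : n ≠ 0) (b : 𝓞 ℂ) : ∃ x : 𝓞 ℂ, x ^ n = b := by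
  obtain ⟨x, hx⟩ := exists_root_of_monic (f := X ^ n - C b) (monic_X_pow_sub_C b hn)
    (by rwa [natDegree_X_pow_sub_C])
  exact ⟨x, by simpa [sub_eq_zero] using hx⟩

theorem exists_pow_eq_lift (π : 𝓞 ℂ →+* k) {n : ℕ} (hn : n ≠ 0) (b : 𝓞 ℂ) {t : k} (ht : t ^ n = π b) :
    ∃ x : 𝓞 ℂ, x ^ n = b ∧ π x = t := by
  obtain ⟨x, hx, hxt⟩ := exists_root_lift π (f := X ^ n - C b) (monic_X_pow_sub_C b hn)
    (c := t) (by simp [ht])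
  exact ⟨x, by simpa [sub_eq_zero] using hx, hxt⟩

/-- Provides generators of 𝔽₄ and 𝔽₉ inside `k`, which is not assumed algebraically closed. -/
theorem exists_quadratic_root_residue (π : 𝓞 ℂ →+* k) (b c : ℤ) : ∃ t : k, t ^ 2 = b * t + c := by
  obtain ⟨x, hx⟩ := exists_quadratic_root b c
  refine ⟨π x, ?_⟩
  have := congrArg π hx
  simp only [map_sub, map_pow, map_mul, map_intCast, map_zero] at this
  linear_combination this

/-- A root `d` of `X ^ e - m` and an `n`-th root of its residue come from a homomorphism on a
pure field of degree `n * e`. -/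
theorem exists_hom_pureField_lift (π : 𝓞 ℂ →+* k) {K : Type*} [Field K]
    [NumberField K] {n e : ℕ} (hn : n ≠ 0) (he : e ≠ 0) {m : ℤ} (hm : Squarefree m) (hu : ¬ IsUnit m) {a : 𝓞 K}
    (ha : a ^ (n * e) = (m : 𝓞 K)) {d : 𝓞 ℂ} (hd : d ^ e = (m : 𝓞 ℂ)) {c : k}
    (hc : c ^ n = π d) : ∃ φ : 𝓞 K →+* 𝓞 ℂ, φ a ^ n = d ∧ π (φ a) = c := by
  obtain ⟨b, hb, hbc⟩ := exists_pow_eq_lift π hn d hc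
  obtain ⟨φ, hφ⟩ := exists_hom_pureField (mul_ne_zero hn he) hm hu ha (b := b)
    (by rw [pow_mul, hb, hd])
  exact ⟨φ, by rw [hφ, hb], by rw [hφ, hbc]⟩

end Lifts

/-! ### The prime 2: the elements ω and w, and prescribed residues. -/

section Two

variable {K : Type*} [Field K] [NumberField K] {m q : ℤ} {a ω : 𝓞 K}

theorem exists_half_one_add (hq : m = 1 + 4 * q) (ha : a ^ 12 = (m : 𝓞 K)) :
    ∃ ω : 𝓞 K, 2 * ω = 1 + a ^ 6 := by
  have ha' : (a : K) ^ 12 = 1 + 4 * q := by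
    have := congrArg (algebraMap (𝓞 K) K) ha
    simpa only [hq, map_pow, map_add, map_mul, map_one, map_ofNat, map_intCast, Int.cast_add,
      Int.cast_mul, Int.cast_one, Int.cast_ofNat] using this
  obtain ⟨ω, hω⟩ := exists_coe_eq_of_quadratic (1 : 𝓞 K) (q : 𝓞 K) (x := (1 + (a : K) ^ 6) / 2)
    (by simp only [map_one, map_intCast]; linear_combination ha' / 4)
  refine ⟨ω, NumberField.RingOfIntegers.coe_injective ?_⟩
  simp only [map_mul, map_ofNat, map_add, map_one, map_pow, hω]
  ring

theorem sq_half_one_add {R : Type*} [CommRing R] [IsDomain R] [CharZero R] {s w : R}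
    (hs : s ^ 2 = 1 + 4 * q) (hw : 2 * w = 1 + s) : w ^ 2 - w = q := by
  have h : (4 : R) * (w ^ 2 - w) = 4 * q := by
    linear_combination hs + (2 * w - 1 + s) * hw
  exact mul_left_cancel₀ (by norm_num) h

/-- The element is integral because w² = ωw + qω, which follows from ω² - ω = 2q. -/
theorem exists_quarter (hq : m = 1 + 8 * q) (ha : a ^ 12 = (m : 𝓞 K))
    (hω : 2 * ω = 1 + a ^ 6) : ∃ w : 𝓞 K, 2 * w = (1 + a ^ 3) * ω := by
  have ha' : (a : K) ^ 12 = 1 + 8 * q := by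
    have := congrArg (algebraMap (𝓞 K) K) ha
    simpa only [hq, map_pow, map_add, map_mul, map_one, map_ofNat, map_intCast, Int.cast_add,
      Int.cast_mul, Int.cast_one, Int.cast_ofNat] using this
  have hω' : 2 * (ω : K) = 1 + (a : K) ^ 6 := by
    simpa only [map_mul, map_ofNat, map_add, map_one, map_pow] using
      congrArg (algebraMap (𝓞 K) K) hω
  have hωq : (ω : K) ^ 2 - ω = (2 * q : ℤ) :=
    sq_half_one_add (s := (a : K) ^ 6) (by push_cast; linear_combination ha') hω'
  push_cast at hωq
  obtain ⟨w, hw⟩ := exists_coe_eq_of_quadratic ω (ω * q) (x := (1 + (a : K) ^ 3) * ω / 2)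
    (by
      simp only [map_mul, map_intCast]
      linear_combination (-(ω : K) ^ 2 / 4) * hω' + (ω : K) / 2 * hωq)
  refine ⟨w, NumberField.RingOfIntegers.coe_injective ?_⟩
  simp only [map_mul, map_ofNat, map_add, map_one, map_pow, hw]
  ring

variable {k : Type*} [Field k]

theorem eq_one_of_pow_four_eq_one (h2 : (2 : k) = 0) {x : k} (hx : x ^ 4 = 1) : x = 1 := by
  have : (x - 1) ^ 4 = 0 := by
    linear_combination hx + (-2 * x ^ 3 + 3 * x ^ 2 - 2 * x + 1) * h2
  exact sub_eq_zero.1 (pow_eq_zero_iff (by norm_num) |>.1 this)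

theorem intCast_eq_one_of_eq (h2 : (2 : k) = 0) (hq : m = 1 + 4 * q) : (m : k) = 1 := by
  rw [hq]
  push_cast
  linear_combination 2 * q * h2

/-- The embedding is built upwards: lift `t` to a root `u` of X² - X - q, take a square root `d` of
2u - 1, the intended image of a⁶, and then a cube root of `d` reducing to `c`. -/
theorem exists_hom_five_mod_eight (π : 𝓞 ℂ →+* k) (hm : Squarefree m) (hu : ¬ IsUnit m)
    (h2 : (2 : k) = 0)
    (hq : m = 1 + 4 * q) (ha : a ^ 12 = (m : 𝓞 K)) (hω : 2 * ω = 1 + a ^ 6) {t c : k}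
    (ht : t ^ 2 = t + q) (hc : c ^ 3 = 1) : ∃ φ : 𝓞 K →+* k, φ ω = t ∧ φ a = c := by
  obtain ⟨u, hu', hut⟩ := exists_quadratic_root_lift π 1 (q : 𝓞 ℂ) (t := t)
    (by simp only [map_one, map_intCast]; linear_combination ht)
  obtain ⟨d, hd⟩ := exists_pow_eq (two_ne_zero) (2 * u - 1)
  have hd4 : d ^ 4 = (m : 𝓞 ℂ) := by
    rw [hq]
    push_cast
    linear_combination (d ^ 2 + 2 * u - 1) * hd + 4 * hu'
  have hπd : π d = 1 := eq_one_of_pow_four_eq_one h2 (by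
    rw [← map_pow, hd4, map_intCast, intCast_eq_one_of_eq h2 hq])
  obtain ⟨φ, hφ, hφc⟩ := exists_hom_pureField_lift π (n := 3) (e := 4) (by norm_num)
    (by norm_num) hm hu ha hd4 (c := c) (by rw [hc, hπd])
  refine ⟨π.comp φ, ?_, hφc⟩
  have h : (2 : 𝓞 ℂ) * φ ω = 2 * u := by
    have := congrArg φ hω
    simp only [map_mul, map_ofNat, map_add, map_one, map_pow] at this
    linear_combination this + (φ a ^ 3 + d) * hφ + hd
  rw [RingHom.comp_apply, mul_left_cancel₀ two_ne_zero h, hut]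

theorem exists_hom_one_mod_eight (π : 𝓞 ℂ →+* k) (hm : Squarefree m) (hu : ¬ IsUnit m)
    (h2 : (2 : k) = 0)
    (hq : m = 1 + 8 * q) (ha : a ^ 12 = (m : 𝓞 K)) (hω : 2 * ω = 1 + a ^ 6) {w : 𝓞 K}
    (hw : 2 * w = (1 + a ^ 3) * ω) {t s c : k}
    (ht : t ^ 2 = t) (hs : s ^ 2 = t * s + t * q) (hc : c ^ 3 = 1) :
    ∃ φ : 𝓞 K →+* k, φ ω = t ∧ φ w = s ∧ φ a = c := by
  have hq0 : (q : 𝓞 ℂ) ≠ 0 := by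
    intro h
    have : q = 0 := by exact_mod_cast h
    exact hu (by rw [hq, this]; simp)
  obtain ⟨u, hu', hut⟩ := exists_quadratic_root_lift π 1 ((2 * q : ℤ) : 𝓞 ℂ) (t := t)
    (by simp only [map_one, map_intCast]; push_cast; linear_combination ht - q * h2)
  push_cast at hu'
  have hu0 : u ≠ 0 := by
    rintro rfl
    apply mul_ne_zero two_ne_zero hq0
    linear_combination -hu'
  obtain ⟨v, hv, hvs⟩ := exists_quadratic_root_lift π u (u * q) (t := s)
    (by rw [map_mul, map_intCast, hut]; linear_combination hs)
  obtain ⟨d₀, hd₀⟩ := exists_pow_eq (two_ne_zero) (2 * u - 1)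
  -- The sign of the square root is chosen so that `d`, the future image of a³, satisfies 2v = (1 +
  -- d)u; `v` is then the image of `w`.
  obtain ⟨d, hd, hdv⟩ : ∃ d : 𝓞 ℂ, d ^ 2 = 2 * u - 1 ∧ u * d = 2 * v - u := by
    have h : (u * d₀) ^ 2 = (2 * v - u) ^ 2 := by
      linear_combination u ^ 2 * hd₀ - 4 * hv + 2 * u * hu'
    rcases sq_eq_sq_iff_eq_or_eq_neg.1 h with h | h
    · exact ⟨d₀, hd₀, h⟩
    · exact ⟨-d₀, by rw [neg_sq, hd₀], by linear_combination -h⟩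
  have hd4 : d ^ 4 = (m : 𝓞 ℂ) := by
    rw [hq]
    push_cast
    linear_combination (d ^ 2 + 2 * u - 1) * hd + 4 * hu'
  have hπd : π d = 1 := eq_one_of_pow_four_eq_one h2 (by
    rw [← map_pow, hd4, map_intCast, intCast_eq_one_of_eq (q := 2 * q) h2 (by rw [hq]; ring)])
  obtain ⟨φ, hφ, hφc⟩ := exists_hom_pureField_lift π (n := 3) (e := 4) (by norm_num)
    (by norm_num) hm hu ha hd4 (c := c) (by rw [hc, hπd])
  have hφω : φ ω = u := by
    have := congrArg φ hω
    simp only [map_mul, map_ofNat, map_add, map_one, map_pow] at this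
    refine mul_left_cancel₀ two_ne_zero (?_ : (2 : 𝓞 ℂ) * φ ω = 2 * u)
    linear_combination this + (φ a ^ 3 + d) * hφ + hd
  have hφw : φ w = v := by
    have := congrArg φ hw
    simp only [map_mul, map_ofNat, map_add, map_one, map_pow, hφω] at this
    refine mul_left_cancel₀ two_ne_zero (?_ : (2 : 𝓞 ℂ) * φ w = 2 * v)
    linear_combination this + u * hφ + hdv
  exact ⟨π.comp φ, by rw [RingHom.comp_apply, hφω, hut], by rw [RingHom.comp_apply, hφw, hvs],
    hφc⟩

end Two

/-! ### The prime 3: the element θ and prescribed residues. -/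

section Three

variable {K : Type*} [Field K] [NumberField K] {m q ε : ℤ} {a θ : 𝓞 K}

theorem exists_third (hε : ε ^ 2 = 1) (hq : ε * m = 1 + 9 * q) (ha : a ^ 12 = (m : 𝓞 K)) :
    ∃ θ : 𝓞 K, 3 * θ = 1 + ε * a ^ 4 + (ε * a ^ 4) ^ 2 := by
  have ha' : ((ε : K) * (a : K) ^ 4) ^ 3 = 1 + 9 * q := by
    have h1 : (a : K) ^ 12 = m := by simpa using congrArg (algebraMap (𝓞 K) K) ha
    have h2 : (ε : K) ^ 2 = 1 := by exact_mod_cast hε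
    have h3 : (ε : K) * m = 1 + 9 * q := by exact_mod_cast hq
    linear_combination (ε : K) ^ 3 * h1 + (ε : K) * m * h2 + h3
  obtain ⟨θ, hθ⟩ := exists_coe_eq_of_cubic (1 : 𝓞 K) (3 * q : 𝓞 K) (3 * q ^ 2 : 𝓞 K)
    (x := (1 + ε * (a : K) ^ 4 + (ε * (a : K) ^ 4) ^ 2) / 3)
    (by
      simp only [map_mul, map_one, map_intCast, map_pow, map_ofNat]
      generalize (ε : K) * (a : K) ^ 4 = y at ha'
      have hqy : (q : K) = (y ^ 3 - 1) / 9 := by linear_combination -ha' / 9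
      rw [hqy]
      ring)
  refine ⟨θ, NumberField.RingOfIntegers.coe_injective ?_⟩
  simp only [map_mul, map_ofNat, map_add, map_one, map_pow, map_intCast, hθ]
  ring

variable {k : Type*} [Field k]

theorem exists_hom_three (π : 𝓞 ℂ →+* k) (hm : Squarefree m) (hu : ¬ IsUnit m) (h3 : (3 : k) = 0)
    (hε : ε ^ 2 = 1) (hq : ε * m = 1 + 9 * q) (ha : a ^ 12 = (m : 𝓞 K))
    (hθ : 3 * θ = 1 + ε * a ^ 4 + (ε * a ^ 4) ^ 2) {t c : k} (ht : t ^ 2 = t) (hc : c ^ 4 = ε) :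
    ∃ φ : 𝓞 K →+* k, φ θ = t ∧ φ a = c := by
  have hε' : (ε : 𝓞 ℂ) ^ 2 = 1 := by exact_mod_cast hε
  have hq' : (ε : 𝓞 ℂ) * m = 1 + 9 * q := by exact_mod_cast hq
  obtain ⟨u, hu', hut⟩ := exists_cubic_root_lift π 1 ((3 * q : ℤ) : 𝓞 ℂ) ((3 * q ^ 2 : ℤ) : 𝓞 ℂ)
    (t := t) (by
      simp only [map_one, map_intCast]
      push_cast
      linear_combination t * ht - (q * t + q ^ 2) * h3)
  push_cast at hu'
  obtain ⟨z, hz⟩ := exists_quadratic_root (-1) (-1)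
  -- Up to the factor 27, the cubic at `u` is the product of 3u - (1 + y + y²) over the three cube
  -- roots of 1 + 9q, so one of them fits `u`.
  obtain ⟨y, hy, hyu⟩ : ∃ y : 𝓞 ℂ, y ^ 3 = 1 + 9 * q ∧ 3 * u = 1 + y + y ^ 2 := by
    obtain ⟨y, hy⟩ := exists_pow_eq three_ne_zero (1 + 9 * q : 𝓞 ℂ)
    have hz3 : z ^ 3 = 1 := by linear_combination (z - 1) * hz
    have hprod : (3 * u - (1 + y + y ^ 2)) * ((3 * u - (1 + z * y + (z * y) ^ 2)) *
        (3 * u - (1 + z ^ 2 * y + (z ^ 2 * y) ^ 2))) = 0 := by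
      have hz1 : 1 + z * y + (z * y) ^ 2 = 1 + z * y + (-1 - z) * y ^ 2 := by
        linear_combination y ^ 2 * hz
      have hz2 : 1 + z ^ 2 * y + (z ^ 2 * y) ^ 2 = 1 + (-1 - z) * y + z * y ^ 2 := by
        linear_combination (y + y ^ 2 * (z ^ 2 - z)) * hz
      have hzz : (3 * u - (1 + z * y + (z * y) ^ 2)) *
          (3 * u - (1 + z ^ 2 * y + (z ^ 2 * y) ^ 2)) =
          (3 * u - 1) ^ 2 + (3 * u - 1) * (y + y ^ 2) + y ^ 2 - y ^ 3 + y ^ 4 := by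
        rw [hz1, hz2]
        linear_combination (-y ^ 2 + 2 * y ^ 3 - y ^ 4) * hz
      rw [hzz]
      linear_combination 27 * hu' - (3 * (3 * u - 1) + y ^ 3 + 2 + 9 * q) * hy
    rcases mul_eq_zero.1 hprod with h | h
    · exact ⟨y, hy, sub_eq_zero.1 h⟩
    rcases mul_eq_zero.1 h with h | h
    · exact ⟨z * y, by rw [mul_pow, hz3, one_mul, hy], sub_eq_zero.1 h⟩
    · exact ⟨z ^ 2 * y, by rw [mul_pow, ← pow_mul, mul_comm 2 3, pow_mul, hz3, one_pow, one_mul,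
        hy], sub_eq_zero.1 h⟩
  have hπy : π y = 1 := by
    have h : (π y - 1) ^ 3 = 0 := by
      have := congrArg π hy
      simp only [map_pow, map_add, map_mul, map_one, map_ofNat, map_intCast] at this
      linear_combination this + (-(π y) ^ 2 + π y + 3 * q) * h3
    exact sub_eq_zero.1 (pow_eq_zero_iff three_ne_zero |>.1 h)
  obtain ⟨φ, hφ, hφc⟩ := exists_hom_pureField_lift π (n := 4) (e := 3) (by norm_num)
    (by norm_num) hm hu ha (d := ε * y)
    (by linear_combination (ε : 𝓞 ℂ) ^ 3 * hy - (ε : 𝓞 ℂ) ^ 3 * hq' + m * (ε ^ 2 + 1) * hε')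
    (c := c) (by rw [hc, map_mul, hπy, mul_one, map_intCast])
  refine ⟨π.comp φ, ?_, hφc⟩
  have hεa : (ε : 𝓞 ℂ) * φ a ^ 4 = y := by linear_combination ε * hφ + y * hε'
  have h : (3 : 𝓞 ℂ) * φ θ = 3 * u := by
    have := congrArg φ hθ
    simp only [map_mul, map_ofNat, map_add, map_one, map_pow, map_intCast, hεa] at this
    rw [this, hyu]
  rw [RingHom.comp_apply, mul_left_cancel₀ (by norm_num) h, hut]

end Three

/-! ### Ramification criteria at 2 and 3. -/

section Factorization

variable {K : Type*} [Field K] [NumberField K] {a ω : 𝓞 K} {k : Type*} [Field k]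
  {r : ℕ} {e f : Fin r → ℕ}

theorem exists_isPrimeFactorization_two (h2 : (2 : k) = 0) (hω : 2 * ω = 1 + a ^ 6)
    (φ : Fin r → 𝓞 K →+* k) (W C : Fin r → k) (hW : ∀ i, φ i ω = W i) (hC : ∀ i, φ i a = C i)
    (hC3 : ∀ i, C i ^ 3 = 1) (hinj : ∀ i j, (∀ x, φ i x = 0 ↔ φ j x = 0) → i = j)
    (he : ∀ i, e i = 1 ∨ e i = 2 ∧ W i + 1 ≠ 0)
    (hf : ∀ i, f i = 1 ∨ f i = 2 ∧ ∃ x, φ i x ^ 2 ≠ φ i x)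
    (hsum : ∑ i, e i * f i = Module.finrank ℚ K) :
    ∃ P : Fin r → Ideal (𝓞 K), IsPrimeFactorization K 2 P e f := by
  refine exists_isPrimeFactorization_of_homs Nat.prime_two (by exact_mod_cast h2) φ hinj ?_ hf hsum
  intro i
  refine (he i).imp_right fun h => ⟨h.1, a ^ 3 + 1, ω + a ^ 3, ?_, ?_, ?_⟩
  · rw [map_add, map_pow, map_one, hC, hC3]
    linear_combination h2
  · push_cast
    linear_combination -hω
  · rw [map_add, map_pow, hC, hC3, hW]
    exact h.2

theorem exists_isPrimeFactorization_three (h3 : (3 : k) = 0) {ε : ℤ} (hε : ε ^ 2 = 1) {θ : 𝓞 K}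
    (hθ : 3 * θ = 1 + ε * a ^ 4 + (ε * a ^ 4) ^ 2)
    (φ : Fin r → 𝓞 K →+* k) (T C : Fin r → k) (hT : ∀ i, φ i θ = T i) (hC : ∀ i, φ i a = C i)
    (hC4 : ∀ i, C i ^ 4 = ε) (hinj : ∀ i j, (∀ x, φ i x = 0 ↔ φ j x = 0) → i = j)
    (he : ∀ i, e i = 1 ∨ e i = 2 ∧ T i - 1 ≠ 0)
    (hf : ∀ i, f i = 1 ∨ f i = 2 ∧ ∃ x, φ i x ^ 3 ≠ φ i x)
    (hsum : ∑ i, e i * f i = Module.finrank ℚ K) :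
    ∃ P : Fin r → Ideal (𝓞 K), IsPrimeFactorization K 3 P e f := by
  refine exists_isPrimeFactorization_of_homs Nat.prime_three (by exact_mod_cast h3) φ hinj ?_ hf
    hsum
  intro i
  have hx : φ i (ε * a ^ 4 - 1) = 0 := by
    rw [map_sub, map_mul, map_intCast, map_pow, map_one, hC, hC4]
    have : (ε : k) ^ 2 = 1 := by rw [← Int.cast_pow, hε, Int.cast_one]
    linear_combination this
  refine (he i).imp_right fun h => ⟨h.1, ε * a ^ 4 - 1, θ - 1 - (ε * a ^ 4 - 1), hx, ?_, ?_⟩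
  · push_cast
    linear_combination -hθ
  · rw [map_sub, hx, sub_zero, map_sub, hT, map_one]
    exact h.2

end Factorization

/-! ### The five congruence classes. -/

section Cases

variable {K : Type*} [Field K] [NumberField K] {m q : ℤ} {a : 𝓞 K}

theorem factorization_two_of_one_mod_sixteen (hm : Squarefree m) (hu : ¬ IsUnit m)
    (hq : m = 1 + 16 * q) (ha : a ^ 12 = (m : 𝓞 K)) (hd : Module.finrank ℚ K = 12) :
    ∃ P : Fin 6 → Ideal (𝓞 K),
      IsPrimeFactorization K 2 P ![1, 1, 2, 1, 1, 2] ![1, 1, 1, 2, 2, 2] := by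
  obtain ⟨k, _, π, h2⟩ := exists_reduction 2 Nat.prime_two
  push_cast at h2
  obtain ⟨ω, hω⟩ := exists_half_one_add (q := 4 * q) (by rw [hq]; ring) ha
  obtain ⟨w, hw⟩ := exists_quarter (q := 2 * q) (by rw [hq]; ring) ha hω
  obtain ⟨z, hz⟩ := exists_quadratic_root_residue π 1 1
  push_cast at hz
  have hz1 : z - 1 ≠ 0 := fun h => one_ne_zero (α := k) (by linear_combination z * h - hz)
  have hzz : z ^ 2 ≠ z := fun h => one_ne_zero (α := k) (by linear_combination h - hz)
  have hz3 : z ^ 3 = 1 := by linear_combination (z + 1) * hz + z * h2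
  -- The constant term of the equation for `w` is even here, so `w` has residue 0 or 1 above ω = 1;
  -- above ω = 0 it has residue 0.
  have H (i : Fin 6) : ∃ φ : 𝓞 K →+* k, φ ω = ![1, 1, 0, 1, 1, 0] i ∧
      φ w = ![0, 1, 0, 0, 1, 0] i ∧ φ a = ![1, 1, 1, z, z, z] i := by
    refine exists_hom_one_mod_eight π hm hu h2 (q := 2 * q) (by rw [hq]; ring) ha hω hw ?_ ?_ ?_ <;>
      fin_cases i <;> simp [h2, hz3]
  choose φ hφω hφw hφa using H
  refine exists_isPrimeFactorization_two h2 hω φ _ _ hφω hφa ?_ ?_ ?_ ?_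
    (by rw [hd]; rfl)
  · intro i
    fin_cases i <;> simp [hz3]
  · intro i j h
    have h1 := h ω
    have h2 := h w
    have h3 := h (a - 1)
    simp only [map_sub, map_one, hφω, hφw, hφa] at h1 h2 h3
    fin_cases i <;> fin_cases j <;> first | rfl | (exfalso; simp [hz1] at h1 h2 h3)
  · intro i
    fin_cases i <;> simp
  · intro i
    fin_cases i <;> simp <;> exact ⟨a, by simpa [hφa] using hzz⟩

theorem factorization_two_of_nine_mod_sixteen (hm : Squarefree m) (hu : ¬ IsUnit m)
    (hq : m = 9 + 16 * q) (ha : a ^ 12 = (m : 𝓞 K)) (hd : Module.finrank ℚ K = 12) :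
    ∃ P : Fin 5 → Ideal (𝓞 K),
      IsPrimeFactorization K 2 P ![1, 2, 1, 1, 2] ![2, 1, 2, 2, 2] := by
  obtain ⟨k, _, π, h2⟩ := exists_reduction 2 Nat.prime_two
  push_cast at h2
  obtain ⟨ω, hω⟩ := exists_half_one_add (q := 2 + 4 * q) (by rw [hq]; ring) ha
  obtain ⟨w, hw⟩ := exists_quarter (q := 1 + 2 * q) (by rw [hq]; ring) ha hω
  obtain ⟨z, hz⟩ := exists_quadratic_root_residue π 1 1
  push_cast at hz
  have hz1 : z - 1 ≠ 0 := fun h => one_ne_zero (α := k) (by linear_combination z * h - hz)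
  have hzz : z ^ 2 ≠ z := fun h => one_ne_zero (α := k) (by linear_combination h - hz)
  have hz3 : z ^ 3 = 1 := by linear_combination (z + 1) * hz + z * h2
  have hz4 : (z ^ 2) ^ 2 = z := by linear_combination z * hz3
  have hzz' : z ^ 2 - z ≠ 0 := sub_ne_zero.2 hzz
  have hq' : z ^ 2 = z + 1 := by linear_combination hz
  have hq'' : z = z ^ 2 + 1 := by linear_combination -hz - h2
  -- Now s² = s + 1 above ω = 1, so `w` generates 𝔽₄. With `a` ↦ `z`, the choices `z` and `z ^ 2`
  -- for `w` are not Frobenius conjugate, and `w - a` separates them.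
  have H (i : Fin 5) : ∃ φ : 𝓞 K →+* k, φ ω = ![1, 0, 1, 1, 0] i ∧
      φ w = ![z, 0, z, z ^ 2, 0] i ∧ φ a = ![1, 1, z, z, z] i := by
    refine exists_hom_one_mod_eight π hm hu h2 (q := 1 + 2 * q) (by rw [hq]; ring) ha hω hw
      ?_ ?_ ?_
    · fin_cases i <;> simp
    · fin_cases i <;> simp [h2, hz4] <;> assumption
    · fin_cases i <;> simp [hz3]
  choose φ hφω hφw hφa using H
  refine exists_isPrimeFactorization_two h2 hω φ _ _ hφω hφa ?_ ?_ ?_ ?_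
    (by rw [hd]; rfl)
  · intro i
    fin_cases i <;> simp [hz3]
  · intro i j h
    have h1 := h ω
    have h2 := h (w - a)
    have h3 := h (a - 1)
    simp only [map_sub, map_one, hφω, hφw, hφa] at h1 h2 h3
    fin_cases i <;> fin_cases j <;> first | rfl | (exfalso; simp [hz1, hzz'] at h1 h2 h3)
  · intro i
    fin_cases i <;> simp
  · intro i
    fin_cases i <;> simp
    · exact ⟨w, by simpa [hφw] using hzz⟩
    all_goals exact ⟨a, by simpa [hφa] using hzz⟩

theorem factorization_two_of_five_mod_eight (hm : Squarefree m) (hu : ¬ IsUnit m)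
    (hq : m = 5 + 8 * q) (ha : a ^ 12 = (m : 𝓞 K)) (hd : Module.finrank ℚ K = 12) :
    ∃ P : Fin 3 → Ideal (𝓞 K), IsPrimeFactorization K 2 P ![2, 2, 2] ![2, 2, 2] := by
  obtain ⟨k, _, π, h2⟩ := exists_reduction 2 Nat.prime_two
  push_cast at h2
  obtain ⟨ω, hω⟩ := exists_half_one_add (q := 1 + 2 * q) (by rw [hq]; ring) ha
  obtain ⟨z, hz⟩ := exists_quadratic_root_residue π 1 1
  push_cast at hz
  have hz1 : z - 1 ≠ 0 := fun h => one_ne_zero (α := k) (by linear_combination z * h - hz)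
  have hzz : z ^ 2 ≠ z := fun h => one_ne_zero (α := k) (by linear_combination h - hz)
  have hz3 : z ^ 3 = 1 := by linear_combination (z + 1) * hz + z * h2
  have hz4 : (z ^ 2) ^ 2 = z := by linear_combination z * hz3
  have hzz' : z ^ 2 - z ≠ 0 := sub_ne_zero.2 hzz
  have hzp : z + 1 ≠ 0 := fun h => hz1 (by linear_combination h - h2)
  have hzp' : z ^ 2 + 1 ≠ 0 := fun h => one_ne_zero (α := k) (by
    linear_combination z ^ 2 * (h - hz - h2) - hz3)
  have hq' : z ^ 2 = z + 1 := by linear_combination hz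
  have hq'' : z = z ^ 2 + 1 := by linear_combination -hz - h2
  -- Here ω itself generates 𝔽₄, and the last two pairs of residues are separated by `ω - a`.
  have H (i : Fin 3) : ∃ φ : 𝓞 K →+* k, φ ω = ![z, z, z ^ 2] i ∧ φ a = ![1, z, z] i := by
    refine exists_hom_five_mod_eight π hm hu h2 (q := 1 + 2 * q) (by rw [hq]; ring) ha hω
      ?_ ?_
    · fin_cases i <;> simp [h2, hz4] <;> assumption
    · fin_cases i <;> simp [hz3]
  choose φ hφω hφa using H
  refine exists_isPrimeFactorization_two h2 hω φ _ _ hφω hφa ?_ ?_ ?_ ?_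
    (by rw [hd]; rfl)
  · intro i
    fin_cases i <;> simp [hz3]
  · intro i j h
    have h2 := h (ω - a)
    have h3 := h (a - 1)
    simp only [map_sub, map_one, hφω, hφa] at h2 h3
    fin_cases i <;> fin_cases j <;> first | rfl | (exfalso; simp [hz1, hzz'] at h2 h3)
  · intro i
    fin_cases i <;> simp [hzp, hzp']
  · intro i
    fin_cases i <;> simp
    · exact ⟨ω, by simpa [hφω] using hzz⟩
    all_goals exact ⟨a, by simpa [hφa] using hzz⟩

theorem factorization_three_of_one_mod_nine (hm : Squarefree m) (hu : ¬ IsUnit m)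
    (hq : m = 1 + 9 * q) (ha : a ^ 12 = (m : 𝓞 K)) (hd : Module.finrank ℚ K = 12) :
    ∃ P : Fin 6 → Ideal (𝓞 K),
      IsPrimeFactorization K 3 P ![1, 2, 1, 2, 1, 2] ![1, 1, 1, 1, 2, 2] := by
  obtain ⟨k, _, π, h3⟩ := exists_reduction 3 Nat.prime_three
  push_cast at h3
  have hq1 : (1 : ℤ) * m = 1 + 9 * q := by rw [hq, one_mul]
  obtain ⟨θ, hθ⟩ := exists_third (one_pow 2) hq1 ha
  obtain ⟨z, hz⟩ := exists_quadratic_root_residue π 0 (-1)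
  push_cast at hz
  have hp1 : (1 : k) + 1 ≠ 0 := fun h => one_ne_zero (α := k) (by linear_combination h3 - h)
  have hm1 : (-1 : k) - 1 ≠ 0 := fun h => hp1 (by linear_combination -h)
  have hzm : z - 1 ≠ 0 := fun h => hp1 (by linear_combination hz - (z + 1) * h)
  have hzp : z + 1 ≠ 0 := fun h => hp1 (by linear_combination hz - (z - 1) * h)
  have hz4 : z ^ 4 = 1 := by linear_combination (z ^ 2 - 1) * hz
  have hzz : z ^ 3 ≠ z := fun h => hp1 (by linear_combination z * h - hz4 + hz)
  have hm4 : (-1 : k) ^ 4 = 1 := by norm_num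
  have H (i : Fin 6) : ∃ φ : 𝓞 K →+* k, φ θ = ![1, 0, 1, 0, 1, 0] i ∧
      φ a = ![1, 1, -1, -1, z, z] i := by
    refine exists_hom_three π hm hu h3 (one_pow 2) hq1 ha hθ ?_ ?_ <;>
      fin_cases i <;> simp [hz4, hm4]
  choose φ hφθ hφa using H
  refine exists_isPrimeFactorization_three h3 (one_pow 2) hθ φ _ _ hφθ hφa ?_ ?_ ?_ ?_
    (by rw [hd]; rfl)
  · intro i
    fin_cases i <;> simp [hz4, hm4]
  · intro i j h
    have h1 := h θ
    have h2 := h (a - 1)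
    have h3 := h (a + 1)
    simp only [map_sub, map_add, map_one, hφθ, hφa] at h1 h2 h3
    fin_cases i <;> fin_cases j <;>
      first | rfl | (exfalso; simp [hm1, hzm, hzp] at h1 h2 h3)
  · intro i
    fin_cases i <;> simp
  · intro i
    fin_cases i <;> simp <;> exact ⟨a, by simpa [hφa] using hzz⟩

theorem factorization_three_of_neg_one_mod_nine (hm : Squarefree m) (hu : ¬ IsUnit m)
    (hq : m = -1 + 9 * q) (ha : a ^ 12 = (m : 𝓞 K)) (hd : Module.finrank ℚ K = 12) :
    ∃ P : Fin 4 → Ideal (𝓞 K),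
      IsPrimeFactorization K 3 P ![1, 2, 1, 2] ![2, 2, 2, 2] := by
  obtain ⟨k, _, π, h3⟩ := exists_reduction 3 Nat.prime_three
  push_cast at h3
  have hε : (-1 : ℤ) ^ 2 = 1 := by norm_num
  have hq1 : (-1 : ℤ) * m = 1 + 9 * (-q) := by rw [hq]; ring
  obtain ⟨θ, hθ⟩ := exists_third hε hq1 ha
  obtain ⟨z, hz⟩ := exists_quadratic_root_residue π (-1) 1
  push_cast at hz
  have hz0 : z ≠ 0 := by
    rintro rfl
    exact one_ne_zero (α := k) (by linear_combination -hz)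
  have hz4 : z ^ 4 = -1 := by linear_combination (z ^ 2 - z + 2) * hz + (1 - z) * h3
  have hzz : z ^ 3 ≠ z := fun h => hz0 (by
    have h1 : z - 1 = 0 := by linear_combination h - z * hz + hz
    linear_combination z * (hz - (z + 2) * h1))
  have hplus : z ^ 2 + z - 1 = 0 := by linear_combination hz
  have hminus : z ^ 2 - z - 1 ≠ 0 := fun h => hz0 (by linear_combination z * h3 + h - hz)
  have H (i : Fin 4) : ∃ φ : 𝓞 K →+* k, φ θ = ![1, 0, 1, 0] i ∧
      φ a = ![z, z, -z, -z] i := by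
    refine exists_hom_three π hm hu h3 hε hq1 ha hθ ?_ ?_ <;>
      fin_cases i <;> simp [hz4, Even.neg_pow (show Even 4 by decide)]
  choose φ hφθ hφa using H
  refine exists_isPrimeFactorization_three h3 hε hθ φ _ _ hφθ hφa ?_ ?_ ?_ ?_
    (by rw [hd]; rfl)
  · intro i
    fin_cases i <;> simp [hz4, Even.neg_pow (show Even 4 by decide)]
  · intro i j h
    have h1 := h θ
    -- Over 𝔽₃, X⁴ + 1 = (X² + X - 1)(X² - X - 1); the first factor kills `z` but not `-z`.
    have h2 := h (a ^ 2 + a - 1)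
    simp only [map_sub, map_add, map_pow, map_one, hφθ, hφa] at h1 h2
    fin_cases i <;> fin_cases j <;>
      first | rfl | (exfalso; simp [hplus, hminus, ← sub_eq_add_neg] at h1 h2)
  · intro i
    fin_cases i <;> simp
  · have hzz' : (-z) ^ 3 ≠ -z := by rwa [Odd.neg_pow (by decide), ne_eq, neg_inj]
    intro i
    fin_cases i <;> simp <;>
      first | exact ⟨a, by simpa [hφa] using hzz⟩ | exact ⟨a, by simpa [hφa] using hzz'⟩

end Cases

theorem lemma4p1 {K : Type*} [Field K] [NumberField K] (m : ℤ) (hm : Squarefree m)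
    (hm1 : m ≠ 1) (hm1' : m ≠ -1) (α : K) (hα : α ^ 12 = (m : K))
    (hK : IntermediateField.adjoin ℚ {α} = ⊤) :
    (m ≡ 1 [ZMOD 16] → ∃ P : Fin 6 → Ideal (𝓞 K),
      IsPrimeFactorization K 2 P ![1, 1, 2, 1, 1, 2] ![1, 1, 1, 2, 2, 2]) ∧
    (m ≡ 9 [ZMOD 16] → ∃ P : Fin 5 → Ideal (𝓞 K),
      IsPrimeFactorization K 2 P ![1, 2, 1, 1, 2] ![2, 1, 2, 2, 2]) ∧
    (m ≡ 5 [ZMOD 8] → ∃ P : Fin 3 → Ideal (𝓞 K),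
      IsPrimeFactorization K 2 P ![2, 2, 2] ![2, 2, 2]) ∧
    (m ≡ 1 [ZMOD 9] → ∃ P : Fin 6 → Ideal (𝓞 K),
      IsPrimeFactorization K 3 P ![1, 2, 1, 2, 1, 2] ![1, 1, 1, 1, 2, 2]) ∧
    (m ≡ -1 [ZMOD 9] → ∃ P : Fin 4 → Ideal (𝓞 K),
      IsPrimeFactorization K 3 P ![1, 2, 1, 2] ![2, 2, 2, 2]) := by
  have hu : ¬ IsUnit m := fun h => (Int.isUnit_iff.1 h).elim hm1 hm1'
  have hd : Module.finrank ℚ K = 12 := finrank_pureField (by norm_num) hm hu hα hK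
  have hint : IsIntegral ℤ α := by
    refine IsIntegral.of_pow (n := 12) (by norm_num) ?_
    rw [hα]
    exact isIntegral_algebraMap (x := m)
  obtain ⟨a, rfl⟩ : ∃ a : 𝓞 K, (a : K) = α := ⟨⟨α, hint⟩, rfl⟩
  have ha : a ^ 12 = (m : 𝓞 K) := NumberField.RingOfIntegers.coe_injective (by simpa using hα)
  refine ⟨fun h => ?_, fun h => ?_, fun h => ?_, fun h => ?_, fun h => ?_⟩ <;>
    obtain ⟨q, hq⟩ := h.symm.dvd
  · exact factorization_two_of_one_mod_sixteen hm hu (q := q) (by linarith) ha hd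
  · exact factorization_two_of_nine_mod_sixteen hm hu (q := q) (by linarith) ha hd
  · exact factorization_two_of_five_mod_eight hm hu (q := q) (by linarith) ha hd
  · exact factorization_three_of_one_mod_nine hm hu (q := q) (by linarith) ha hd
  · exact factorization_three_of_neg_one_mod_nine hm hu (q := q) (by linarith) ha hd
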